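/- **Setting.** A seller faces $k\ge 2$ bidders for $T$ rounds and sells one divisible item per round. Bidder $i$ has values $v_{i,t}\in[0,1]$, known to bidder $i$ and unknown to the seller. A *mechanism* for $(k,T)$ is a set of rules to which the seller commits, which may use private randomness of the seller drawn from a finite probability space, but not the valuations. In each round $t$ the seller sends a private signal to each bidder, the bidders simultaneously reply with messages, the seller gives fractions $r_{i,t}\ge 0$ of the item to the bidders, $\sum_i r_{i,t}\le 1$, and each bidder $i$ then pays an amount $p_{i,t}$ of his own choice. After round $T$ the seller pays a reimbursement $g_i\ge 0$ to each bidder $i$. All these rules may depend on the seller's randomness and on everything that has happened before. A pure strategy of a bidder chooses messages and payments as functions of what the bidder has seen so far (his own signals, messages, allocations and payments). It is *feasible* for valuations $w\in[0,1]^T$ (limited liability) if it always pays an amount in $[0, r\,w_t]$ when the bidder receives the fraction $r$ in round $t$. The utility of bidder $i$ is the expectation of $\sum_t (r_{i,t}v_{i,t}-p_{i,t})+g_i$, and the revenue is the expectation of $\sum_{i,t}p_{i,t}-\sum_i g_i$. For bidder $i$ with valuations $w$, a (mixed) strategy $\sigma$ *weakly dominates* a pure strategy $s_i$ if $U_i(s_i,s_{-i})\le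 U_i(\sigma,s_{-i})$ for all pure strategies $s_{-i}$ of the others (each feasible for some valuations in $[0,1]^T$), with strict inequality for at least one $s_{-i}$. A feasible pure strategy is *non-dominated* if no mixture of feasible strategies weakly dominates it; a mixed strategy is non-dominated if it is supported on non-dominated pure strategies. Mixtures are countably supported. Let ${\sf Rev}_{STB}(\mathbf v)$ be the second largest (with multiplicity) of the numbers $\sum_{t} v_{i,t}$, $i=1,\dots,k$. **Corollary 4.6.** There are absolute constants $\alpha>0$, $G$ and $C$ such that for all $k\ge 2$ and all $T$ there is a mechanism for $k$ bidders and $T$ rounds with the following properties. 1. Every reimbursement is at most $G$. 2. For each bidder and all valuations in $[0,1]^T$, every feasible pure strategy that is not non-dominated is weakly dominated by a non-dominated mixed strategy (in particular, non-dominated strategies exist). 3. For all valuation profiles $\mathbf v\in[0,1]^{k\times T}$, if all bidders play non-dominated (possibly mixed) strategies, then the expected revenue is at least $\alpha\,{\sf Rev}_{STB}(\mathbf v)-C\,k$. (This holds also if the bidders' mixed strategies are correlated.) -/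

import Mathlib

noncomputable section

namespace DynamicSale

/-- What one bidder sees of one past round: the signal received from the seller, the message sent
to the seller, the fraction of the item received, and the price paid. -/
structure View (Sig Msg : Type) where
  sig : Sig
  msg : Msg
  alloc : ℝ
  pay : ℝ

/-- The complete record of one round of the game with `k` bidders. -/
structure Record (k : ℕ) (Sig Msg : Type) where
  sig : Fin k → Sig
  msg : Fin k → Msg
  alloc : Fin k → ℝ
  pay : Fin k → ℝ

/-- The part of a round that bidder `i` sees. -/
def Record.view {k : ℕ} {Sig Msg : Type} (c : Record k Sig Msg) (i : Fin k) : View Sig Msg :=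
  ⟨c.sig i, c.msg i, c.alloc i, c.pay i⟩

/-- A (randomized) mechanism to which the seller commits, for `k` bidders and `T` rounds.
The private randomness of the seller is an element of the finite probability space `(Ω, coin)`.
In each round the seller sends a private signal to every bidder, the bidders simultaneously reply
with messages, the seller hands out fractions of the item of this round, and then every bidder
chooses a payment. After the last round the seller reimburses the bidders. The rules of the seller
see the randomness and everything that happened so far, but not the valuations. -/
structure Mechanism (k T : ℕ) where
  Ω : Type
  fintypeΩ : Fintype Ω
  coin : PMF Ω
  Sig : Type
  Msg : Type
  nonemptyMsg : Nonempty Msg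
  signal : Ω → Fin T → List (Record k Sig Msg) → Fin k → Sig
  alloc : Ω → Fin T → List (Record k Sig Msg) → (Fin k → Msg) → Fin k → ℝ
  alloc_nonneg : ∀ ω t h m i, 0 ≤ alloc ω t h m i
  alloc_sum_le : ∀ ω t h m, ∑ i, alloc ω t h m i ≤ 1
  reimb : Ω → List (Record k Sig Msg) → Fin k → ℝ
  reimb_nonneg : ∀ ω h i, 0 ≤ reimb ω h i

/-- The admissible valuations of one bidder. -/
def IsType {T : ℕ} (w : Fin T → ℝ) : Prop :=
  ∀ t, 0 ≤ w t ∧ w t ≤ 1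

/-- The second largest of the numbers `x i` (with multiplicity): the largest value of
`min (x i) (x j)` over pairs of distinct indices. -/
def secondLargest {k : ℕ} (x : Fin k → ℝ) : ℝ :=
  ⨆ p : {p : Fin k × Fin k // p.1 ≠ p.2}, min (x p.1.1) (x p.1.2)

/-- The revenue of selling the business: the second largest total value of a bidder. -/
def revSTB {k T : ℕ} (v : Fin k → Fin T → ℝ) : ℝ :=
  secondLargest fun i => ∑ t, v i t

/-- A pure strategy of a bidder: in round `t`, given what the bidder saw in the earlier rounds and
the current signal, the message to send; and, given moreover the fraction of the item received in
this round, the price to pay. -/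
structure Strategy (T : ℕ) (Sig Msg : Type) where
  msg : Fin T → List (View Sig Msg) → Sig → Msg
  pay : Fin T → List (View Sig Msg) → Sig → ℝ → ℝ

/-- The strategy is available to a bidder with limited liability and valuations `w`: payments are
nonnegative and never exceed the bidder's value for the fraction received in the round. -/
def Strategy.Feasible {T : ℕ} {Sig Msg : Type} (a : Strategy T Sig Msg) (w : Fin T → ℝ) : Prop :=
  ∀ t h s r, 0 ≤ r → 0 ≤ a.pay t h s r ∧ a.pay t h s r ≤ r * w t

namespace Mechanism

variable {k T : ℕ} (M : Mechanism k T)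

/-- The pure strategies of a bidder in the mechanism `M`. -/
abbrev Strat : Type := Strategy T M.Sig M.Msg

/-- Round `t` after the history `h`, if the seller's randomness is `ω` and the bidders play `s`. -/
def round (ω : M.Ω) (s : Fin k → M.Strat) (t : Fin T) (h : List (Record k M.Sig M.Msg)) :
    Record k M.Sig M.Msg :=
  let sig := M.signal ω t h
  let msg : Fin k → M.Msg := fun i => (s i).msg t (h.map fun c => c.view i) (sig i)
  let al := M.alloc ω t h msg
  ⟨sig, msg, al, fun i => (s i).pay t (h.map fun c => c.view i) (sig i) (al i)⟩

/-- The history of the first `n` rounds, in chronological order. -/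
def hist (ω : M.Ω) (s : Fin k → M.Strat) : (n : ℕ) → n ≤ T → List (Record k M.Sig M.Msg)
  | 0, _ => []
  | n + 1, hn =>
      hist ω s n (Nat.le_of_succ_le hn) ++
        [M.round ω s ⟨n, hn⟩ (hist ω s n (Nat.le_of_succ_le hn))]

/-- What happens in round `t`. -/
def outcome (ω : M.Ω) (s : Fin k → M.Strat) (t : Fin T) : Record k M.Sig M.Msg :=
  M.round ω s t (M.hist ω s t t.2.le)

/-- The reimbursement of bidder `i` at the end of the game. -/
def finalReimb (ω : M.Ω) (s : Fin k → M.Strat) (i : Fin k) : ℝ :=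
  M.reimb ω (M.hist ω s T le_rfl) i

/-- Expectation over the randomness of the seller. -/
def expect (f : M.Ω → ℝ) : ℝ :=
  letI := M.fintypeΩ
  ∑ ω, (M.coin ω).toReal * f ω

/-- Expected utility of bidder `i` with valuations `w` under the pure strategy profile `s`. -/
def utility (i : Fin k) (w : Fin T → ℝ) (s : Fin k → M.Strat) : ℝ :=
  M.expect fun ω =>
    ∑ t, ((M.outcome ω s t).alloc i * w t - (M.outcome ω s t).pay i) + M.finalReimb ω s i

/-- Expected revenue of the seller under the pure strategy profile `s`: payments minus
reimbursements. -/
def revenue (s : Fin k → M.Strat) : ℝ :=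
  M.expect fun ω => ∑ i, ∑ t, (M.outcome ω s t).pay i - ∑ i, M.finalReimb ω s i

/-- Expected revenue if the strategy profile is drawn from `π`. -/
def mixedRevenue (π : PMF (Fin k → M.Strat)) : ℝ :=
  ∑' s, (π s).toReal * M.revenue s

/-- Expected utility of bidder `i` with valuations `w` playing the pure strategy `a`, against the
strategies of the other bidders in `s` (the `i`-th entry of `s` is irrelevant). -/
def utilityAgainst (i : Fin k) (w : Fin T → ℝ) (a : M.Strat) (s : Fin k → M.Strat) : ℝ :=
  M.utility i w (Function.update s i a)

/-- The same for a mixed strategy of bidder `i`. -/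
def mixedUtilityAgainst (i : Fin k) (w : Fin T → ℝ) (σ : PMF M.Strat) (s : Fin k → M.Strat) : ℝ :=
  ∑' b, (σ b).toReal * M.utilityAgainst i w b s

/-- In `s`, every bidder other than `i` plays a pure strategy that is available to a bidder with
some admissible valuations. (Bidder `i` does not know the valuations of the others.) -/
def Opponents (i : Fin k) (s : Fin k → M.Strat) : Prop :=
  ∀ j, j ≠ i → ∃ w' : Fin T → ℝ, IsType w' ∧ (s j).Feasible w'

/-- For bidder `i` with valuations `w`, the mixed strategy `σ` weakly dominates the pure strategy
`a`. -/
def WeaklyDominates (i : Fin k) (w : Fin T → ℝ) (σ : PMF M.Strat) (a : M.Strat) : Prop :=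
  (∀ s, M.Opponents i s → M.utilityAgainst i w a s ≤ M.mixedUtilityAgainst i w σ s) ∧
    ∃ s, M.Opponents i s ∧ M.utilityAgainst i w a s < M.mixedUtilityAgainst i w σ s

/-- A non-dominated pure strategy of bidder `i` with valuations `w`: it is available to this
bidder, and no mixture of available strategies weakly dominates it. -/
def NonDominated (i : Fin k) (w : Fin T → ℝ) (a : M.Strat) : Prop :=
  a.Feasible w ∧
    ¬ ∃ σ : PMF M.Strat, (∀ b ∈ σ.support, b.Feasible w) ∧ M.WeaklyDominates i w σ a

/-- Non-dominated strategies are a meaningful prediction in `M`: each available strategy that is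
not itself non-dominated is weakly dominated by a mixture of non-dominated ones. In particular
each bidder has a non-dominated strategy. -/
def IsBounded : Prop :=
  ∀ (i : Fin k) (w : Fin T → ℝ), IsType w → ∀ a : M.Strat, a.Feasible w → ¬ M.NonDominated i w a →
    ∃ σ : PMF M.Strat, (∀ b ∈ σ.support, M.NonDominated i w b) ∧ M.WeaklyDominates i w σ a

end Mechanism

end DynamicSale

end

noncomputable section

namespace DynamicSale

open Finset

/-! ### A single bidder against a fixed sequence of rival bids -/

/-! All valuations are reported in the first round, whose item is not sold; afterwards a second
price auction is run on the reports. The seller puts each bidder on the better, according to his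
report, of two plans. The basic plan gives half of every won item at the rival bid. The business
plan has an entrance price `P`, a 1/32 of the largest total report of the others. Limited liability
forbids collecting `P` in advance, so it is paid in instalments: the bidder gets a quarter of each
won item and hands over the reported surplus on it until `P` is paid, and gets whole items from then
on.

Neither the rival bids nor `P` depend on the bidder's own report. A false report can only help by
reaching the full rate too early, but instalments must be affordable: whoever has paid `P` this way
had enough true surplus to reach the full rate by reporting truthfully (`sum_surplus_le`). A bidder
who departs from the dues is excluded, so he gains at most the value of one round, which is less
than the bonus 2 he loses (`sum_gain_cases`).

Hence `truthful` is optimal among feasible strategies against all opponents, which gives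
boundedness. A non-dominated strategy must attain the same utility against all opponents. This
forces it to pay all dues (`payment_of_nonDominated`) and, tested against rival bids separating a
false report from the true value, to report truthfully after the first round
(`report_of_nonDominated`). The revenue is thus determined by the valuations.

For the revenue (`le_sum_sum_due`), let `Q` be the largest total among the rivals of the top bidder.
Either the second prices add up to `Q / 2`, and a quarter of them is collected, or the top bidder
has surplus more than `Q / 2`, joins the business plan and pays `Q / 32`. -/

/-- The reported surplus over the rival bid. -/
def gap (w m : ℕ → ℝ) (t : ℕ) : ℝ := max (w t - m t) 0

/-- The reported surplus accumulated before round `n`. -/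
def cumGap (w m : ℕ → ℝ) (n : ℕ) : ℝ := ∑ t ∈ range n, gap w m t

/-- The fraction of a won item in the business plan: a quarter until the entrance price `P` has
been collected, and the whole item from then on. -/
def rate (w m : ℕ → ℝ) (P : ℝ) (t : ℕ) : ℝ := if 4 * P ≤ cumGap w m t then 1 else 1 / 4

/-- The value of the business plan for a truthful bidder. -/
def planValue (w m : ℕ → ℝ) (P : ℝ) (T : ℕ) : ℝ :=
  ∑ t ∈ range T, rate w m P t * gap w m t - min P (cumGap w m T / 4)

/-- The bidder prefers the business plan to the basic plan, which consists of one half of every won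
item at the rival bid. -/
def Joins (w m : ℕ → ℝ) (P : ℝ) (T : ℕ) : Prop := cumGap w m T / 2 < planValue w m P T

open Classical in
/-- The fraction of a won item under the preferred plan. -/
def share (w m : ℕ → ℝ) (P : ℝ) (T t : ℕ) : ℝ := if Joins w m P T then rate w m P t else 1 / 2

open Classical in
/-- The instalment of the entrance price that is due in round `t`. -/
def fee (w m : ℕ → ℝ) (P : ℝ) (T t : ℕ) : ℝ :=
  if Joins w m P T then min P (cumGap w m (t + 1) / 4) - min P (cumGap w m t / 4) else 0

open Classical in
/-- The fraction of the item allocated, if the bidder wins in the rounds `win`. -/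
def portion (win : ℕ → Prop) (w m : ℕ → ℝ) (P : ℝ) (T t : ℕ) : ℝ :=
  if win t then share w m P T t else 0

/-- The payment due: the rival bid for the allocated fraction, and the instalment. -/
def dues (win : ℕ → Prop) (w m : ℕ → ℝ) (P : ℝ) (T t : ℕ) : ℝ :=
  portion win w m P T t * m t + fee w m P T t

/-- The utility of a truthful bidder. -/
def bestValue (w m : ℕ → ℝ) (P : ℝ) (T : ℕ) : ℝ := max (cumGap w m T / 2) (planValue w m P T)

section Sequences

variable {win : ℕ → Prop} {u w m : ℕ → ℝ} {P : ℝ} {T n t : ℕ}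

lemma gap_nonneg : 0 ≤ gap w m t := le_max_right _ _

lemma cumGap_succ : cumGap w m (n + 1) = cumGap w m n + gap w m n := sum_range_succ _ _

lemma cumGap_mono : Monotone (cumGap w m) :=
  monotone_nat_of_le_succ fun n => by
    have := @gap_nonneg w m n
    rw [cumGap_succ]; linarith

lemma cumGap_nonneg : 0 ≤ cumGap w m n := sum_nonneg fun _ _ => gap_nonneg

lemma rate_pos : 0 < rate w m P t := by unfold rate; split_ifs <;> norm_num

lemma quarter_le_rate : 1 / 4 ≤ rate w m P t := by unfold rate; split_ifs <;> norm_num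

lemma rate_le_one : rate w m P t ≤ 1 := by unfold rate; split_ifs <;> norm_num

lemma quarter_le_share : 1 / 4 ≤ share w m P T t := by
  unfold share; split_ifs
  · exact quarter_le_rate
  · norm_num

lemma share_le_one : share w m P T t ≤ 1 := by
  unfold share; split_ifs
  · exact rate_le_one
  · norm_num

lemma portion_nonneg : 0 ≤ portion win w m P T t := by
  unfold portion; split_ifs
  · linarith [@quarter_le_share w m P T t]
  · exact le_rfl

lemma portion_le_one : portion win w m P T t ≤ 1 := by
  unfold portion; split_ifs
  · exact share_le_one
  · norm_num

lemma fee_nonneg : 0 ≤ fee w m P T t := by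
  unfold fee; split_ifs
  · have := @cumGap_mono w m _ _ (Nat.le_succ t)
    exact sub_nonneg.2 (min_le_min_left _ (by simpa using by linarith))
  · exact le_rfl

lemma dues_nonneg (hm : 0 ≤ m t) : 0 ≤ dues win w m P T t :=
  add_nonneg (mul_nonneg portion_nonneg hm) fee_nonneg

open Classical in
lemma sum_fee (hP : 0 ≤ P) :
    ∑ t ∈ range n, fee w m P T t = if Joins w m P T then min P (cumGap w m n / 4) else 0 := by
  unfold fee
  split_ifs
  · rw [sum_range_sub fun t => min P (cumGap w m t / 4)]
    simp [cumGap, hP]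
  · simp

lemma sum_rate_mul_gap_of_lt (h : cumGap w m n < 4 * P) :
    ∑ t ∈ range n, rate w m P t * gap w m t = cumGap w m n / 4 := by
  rw [cumGap, sum_div]
  refine sum_congr rfl fun t ht => ?_
  have : cumGap w m t < 4 * P := (cumGap_mono (mem_range.1 ht).le).trans_lt h
  rw [rate, if_neg this.not_ge]; ring

lemma bestValue_nonneg : 0 ≤ bestValue w m P T :=
  le_max_of_le_left (div_nonneg cumGap_nonneg two_pos.le)

lemma portion_mul_sub (h₁ : win t → m t ≤ w t) (h₂ : ¬ win t → w t ≤ m t) :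
    portion win w m P T t * (w t - m t) = share w m P T t * gap w m t := by
  unfold portion gap
  split_ifs with h
  · rw [max_eq_left (sub_nonneg.2 (h₁ h))]
  · rw [max_eq_right (sub_nonpos.2 (h₂ h))]; ring

/-- While `P` is being collected, an instalment is at most a quarter of the gap, exactly what the
allocated quarter is worth beyond the rival bid; later it is zero. This makes the dues compatible
with limited liability. -/
lemma fee_le_share_mul_gap : fee w m P T t ≤ share w m P T t * gap w m t := by
  have hg := @gap_nonneg w m t
  unfold fee share rate
  rw [cumGap_succ]
  split_ifs with h h'
  · rw [min_eq_left (by linarith), min_eq_left (by linarith)]; linarith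
  · rw [min_eq_right (by linarith : cumGap w m t / 4 ≤ P)]
    linarith [min_le_right P ((cumGap w m t + gap w m t) / 4)]
  · linarith

/-- The payment that is due never exceeds the reported value of the allocated fraction. -/
lemma dues_le (h₁ : win t → m t ≤ w t) (h₂ : ¬ win t → w t ≤ m t) :
    dues win w m P T t ≤ portion win w m P T t * w t := by
  have h := portion_mul_sub (P := P) (T := T) h₁ h₂
  have h' := @fee_le_share_mul_gap w m P T t
  unfold dues
  linarith

lemma sum_surplus : ∑ t ∈ range n, (portion win w m P T t * u t - dues win w m P T t) =
    ∑ t ∈ range n, portion win w m P T t * (u t - m t) - ∑ t ∈ range n, fee w m P T t := by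
  rw [← sum_sub_distrib]
  exact sum_congr rfl fun t _ => by unfold dues; ring

/-- The seller selects the plan by comparing the same two values whose maximum is `bestValue`. -/
lemma sum_surplus_truthful (hP : 0 ≤ P) (h₁ : ∀ t, win t → m t ≤ w t)
    (h₂ : ∀ t, ¬ win t → w t ≤ m t) :
    ∑ t ∈ range T, (portion win w m P T t * w t - dues win w m P T t) = bestValue w m P T := by
  rw [sum_surplus, sum_fee hP, sum_congr rfl fun t _ => portion_mul_sub (h₁ t) (h₂ t)]
  unfold share bestValue
  split_ifs with h
  · exact (max_eq_right h.le).symm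
  · rw [max_eq_left (not_lt.1 h), cumGap, sum_div, sub_zero]
    exact sum_congr rfl fun t _ => by ring

/-! ### Misreports under limited liability -/

/-- A bidder with values `u` who reports `w` and can afford all payments that are due before
round `n` does not gain more in these rounds than by reporting `u`. -/
lemma sum_surplus_le (hP : 0 ≤ P) (hn : n ≤ T)
    (h : ∀ t < n, dues win w m P T t ≤ portion win w m P T t * u t) :
    ∑ t ∈ range n, (portion win w m P T t * u t - dues win w m P T t) ≤ bestValue u m P T := by
  have hgap : ∀ t, u t - m t ≤ gap u m t := fun t => le_max_left _ _
  have hfee : ∀ t < n, fee w m P T t ≤ portion win w m P T t * (u t - m t) := fun t ht => by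
    have := h t ht
    unfold dues at this
    linarith
  rw [sum_surplus, sum_fee hP]
  by_cases hJ : Joins w m P T
  swap
  · rw [if_neg hJ, sub_zero]
    refine le_max_of_le_left (le_trans ?_ (div_le_div_of_nonneg_right (cumGap_mono hn) two_pos.le))
    rw [cumGap, sum_div]
    refine sum_le_sum fun t _ => ?_
    have h1 := hgap t
    have h2 := @gap_nonneg u m t
    unfold portion share
    rw [if_neg hJ]
    split_ifs <;> linarith
  rw [if_pos hJ]
  have hport : ∀ t, portion win w m P T t * (u t - m t) ≤ rate w m P t * gap u m t := fun t => by
    have h2 := @gap_nonneg u m t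
    unfold portion share
    rw [if_pos hJ]
    split_ifs
    · exact mul_le_mul_of_nonneg_left (hgap t) rate_pos.le
    · rw [zero_mul]; exact mul_nonneg rate_pos.le h2
  -- If `P` is not fully collected, only quarters were received, which is worse than the halves of
  -- the basic plan.
  by_cases hD : cumGap w m n < 4 * P
  · refine le_max_of_le_left ?_
    have h1 : ∑ t ∈ range n, portion win w m P T t * (u t - m t) ≤ cumGap u m n / 4 := by
      rw [cumGap, sum_div]
      refine sum_le_sum fun t ht => (hport t).trans ?_
      have : cumGap w m t < 4 * P := (cumGap_mono (mem_range.1 ht).le).trans_lt hD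
      rw [rate, if_neg this.not_ge]; linarith
    have h2 : 0 ≤ min P (cumGap w m n / 4) :=
      le_min hP (div_nonneg cumGap_nonneg (by norm_num))
    have h3 := @cumGap_mono u m _ _ hn
    have h4 := @cumGap_nonneg u m n
    linarith
  · have hD := not_lt.1 hD
    refine le_max_of_le_right ?_
    -- An instalment is either zero or is paid out of a quarter of the true gap. So the true
    -- cumulative gap has reached `4 * P` whenever the reported one has, and the truthful rate is at
    -- least as high.
    have hpaid : ∀ t ≤ n, min P (cumGap w m t / 4) ≤ cumGap u m t / 4 := fun t ht => by
      have := sum_fee (w := w) (m := m) (T := T) (n := t) hP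
      rw [if_pos hJ] at this
      rw [← this, cumGap, sum_div]
      refine sum_le_sum fun s hs => ?_
      have h1 := (hfee s ((mem_range.1 hs).trans_le ht)).trans (hport s)
      have h2 := @gap_nonneg u m s
      by_cases hr : 4 * P ≤ cumGap w m s
      · have h3 := @gap_nonneg w m s
        rw [fee, if_pos hJ, cumGap_succ, min_eq_left (by linarith), min_eq_left (by linarith)]
        linarith
      · rw [rate, if_neg hr] at h1; linarith
    have hrate : ∀ t ≤ n, rate w m P t ≤ rate u m P t := fun t ht => by
      have h1 := hpaid t ht
      unfold rate
      split_ifs with h2 h3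
      · exact le_rfl
      · rw [min_eq_left (by linarith)] at h1; exact absurd (by linarith) h3
      · norm_num
      · exact le_rfl
    unfold planValue
    rw [min_eq_left (by linarith : P ≤ cumGap w m n / 4)]
    have h1 : ∑ t ∈ range n, portion win w m P T t * (u t - m t) ≤
        ∑ t ∈ range n, rate u m P t * gap u m t := sum_le_sum fun t ht =>
      (hport t).trans (mul_le_mul_of_nonneg_right (hrate t (mem_range.1 ht).le) gap_nonneg)
    have h2 : ∑ t ∈ range n, rate u m P t * gap u m t ≤ ∑ t ∈ range T, rate u m P t * gap u m t :=
      sum_le_sum_of_subset_of_nonneg (range_mono hn) fun t _ _ =>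
        mul_nonneg rate_pos.le gap_nonneg
    linarith [min_le_left P (cumGap u m T / 4)]

/-- A wrong report in round `t` is costly if the rival bid separates it from the true value and
all other rival bids are prohibitive. -/
lemma sum_surplus_lt (h₁ : ∀ t, m t < w t → win t)
    (h₂ : ∀ t, w t < m t → ¬ win t) (ht : t < T) (hu : ∀ s, s < T → s ≠ t → u s ≤ m s)
    (hs : w t < m t ∧ m t < u t ∨ u t < m t ∧ m t < w t) :
    ∑ s ∈ range T, (portion win w m P T s * u s - dues win w m P T s) < bestValue u m P T := by
  rw [sum_surplus]
  have hf : 0 ≤ ∑ s ∈ range T, fee w m P T s := sum_nonneg fun _ _ => fee_nonneg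
  have hle : ∑ s ∈ range T, portion win w m P T s * (u s - m s) ≤
      portion win w m P T t * (u t - m t) := by
    rw [← add_sum_erase _ _ (mem_range.2 ht)]
    have : ∑ s ∈ (range T).erase t, portion win w m P T s * (u s - m s) ≤ 0 :=
      sum_nonpos fun s hs => mul_nonpos_of_nonneg_of_nonpos portion_nonneg
        (sub_nonpos.2 (hu s (mem_range.1 (mem_erase.1 hs).2) (mem_erase.1 hs).1))
    linarith
  rcases hs with ⟨hw, hu'⟩ | ⟨hu', hw⟩
  · have h1 : gap u m t ≤ cumGap u m T :=
      single_le_sum (f := gap u m) (fun _ _ => gap_nonneg) (mem_range.2 ht)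
    have h2 : u t - m t ≤ gap u m t := le_max_left _ _
    have h3 : cumGap u m T / 2 ≤ bestValue u m P T := le_max_left _ _
    rw [portion, if_neg (h₂ t hw)] at hle
    linarith
  · have h1 := @bestValue_nonneg u m P T
    have h2 := @quarter_le_share w m P T t
    rw [portion, if_pos (h₁ t hw)] at hle
    nlinarith

/-! ### Joining the business plan, and exclusion of defaulters -/

/-- A bidder whose surplus is large compared with the entrance price joins the business plan. -/
lemma joins_of_lt (hP : 0 ≤ P) (hd : ∀ t, gap w m t ≤ 1) (h : 8 * P + 3 / 2 < cumGap w m T) :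
    Joins w m P T := by
  -- Three quarters of the surplus are forgone until it reaches `4 * P`, overshooting by at most one
  -- round: a loss of at most `3 / 4 * (4 * P + 1)`.
  have key : ∀ n, cumGap w m n - 3 * P - 3 / 4 ≤ ∑ t ∈ range n, rate w m P t * gap w m t := by
    intro n
    induction n with
    | zero => simp only [cumGap, sum_range_zero]; linarith
    | succ n ih =>
      rw [sum_range_succ, cumGap_succ]
      by_cases hn : 4 * P ≤ cumGap w m n
      · rw [rate, if_pos hn]; linarith
      · rw [sum_rate_mul_gap_of_lt (not_le.1 hn), rate, if_neg hn]
        linarith [hd n]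
  unfold Joins planValue
  linarith [key T, min_le_left P (cumGap w m T / 4)]

/-- The payments of a bidder who joins the business plan cover the entrance price. -/
lemma le_sum_dues (hP : 0 ≤ P) (hm : ∀ t, 0 ≤ m t) (hd : ∀ t, gap w m t ≤ 1)
    (h : 8 * P + 3 / 2 < cumGap w m T) : P ≤ ∑ t ∈ range T, dues win w m P T t := by
  have h1 := sum_fee (w := w) (m := m) (T := T) (n := T) hP
  rw [if_pos (joins_of_lt hP hd h), min_eq_left (by linarith)] at h1
  exact h1.symm.le.trans <| sum_le_sum fun t _ => le_add_of_nonneg_left (mul_nonneg portion_nonneg (hm t))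

/-- A bidder who is excluded after the first round in which the payment differs from the dues `q`
either pays all dues or gains at most one unit by the first deviation. -/
lemma sum_gain_cases {x q p a : ℕ → ℝ} {B : ℝ} (hu : ∀ t, 0 ≤ u t ∧ u t ≤ 1) (hx : ∀ t, x t ≤ 1)
    (hp : ∀ t < T, 0 ≤ p t ∧ p t ≤ a t * u t)
    (ha : ∀ t < T, (∀ s < t, p s = q s) → a t * u t = x t * u t)
    (ha' : ∀ t < T, ∀ s < t, p s ≠ q s → a t * u t = 0)
    (hB : ∀ n ≤ T, (∀ t < n, q t ≤ x t * u t) → ∑ t ∈ range n, (x t * u t - q t) ≤ B) :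
    (¬ ∀ t < T, p t = q t) ∧ ∑ t ∈ range T, (a t * u t - p t) ≤ B + 1 ∨
      (∀ t < T, p t = q t) ∧ ∑ t ∈ range T, (x t * u t - q t) ≤ B := by
  classical
  have key : ∀ n ≤ T, (∀ t < n, p t = q t) →
      ∑ t ∈ range n, (a t * u t - p t) = ∑ t ∈ range n, (x t * u t - q t) ∧
        ∑ t ∈ range n, (x t * u t - q t) ≤ B := fun n hn h => by
    have hau : ∀ t < n, a t * u t = x t * u t := fun t ht =>
      ha t (ht.trans_le hn) fun s hs => h s (hs.trans ht)
    refine ⟨sum_congr rfl fun t ht => ?_, hB n hn fun t ht => ?_⟩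
    · rw [hau t (mem_range.1 ht), h t (mem_range.1 ht)]
    · rw [← hau t ht, ← h t ht]; exact (hp t (ht.trans_le hn)).2
  by_cases h : ∃ t, t < T ∧ p t ≠ q t
  · left
    refine ⟨fun hc => h.elim fun t ht => ht.2 (hc t ht.1), ?_⟩
    have hlt := (Nat.find_spec h).1
    have hne := (Nat.find_spec h).2
    have hmin : ∀ t < Nat.find h, p t = q t := fun t ht => by
      by_contra hc
      exact Nat.find_min h ht ⟨ht.trans hlt, hc⟩
    set n := Nat.find h
    -- After the exclusion nothing of value is received, so limited liability forces the payments to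
    -- vanish.
    have hlast : ∑ t ∈ Ico n T, (a t * u t - p t) = a n * u n - p n := by
      refine sum_eq_single_of_mem n (by simp [hlt]) fun t ht htn => ?_
      rw [mem_Ico] at ht
      have h0 := ha' t ht.2 n (lt_of_le_of_ne ht.1 (Ne.symm htn)) hne
      have h1 := hp t ht.2
      linarith
    have hn := key n hlt.le hmin
    rw [← sum_range_add_sum_Ico _ hlt.le, hlast, hn.1, ha n hlt hmin]
    have h1 := mul_le_mul (hx n) (hu n).2 (hu n).1 zero_le_one
    have h2 := (hp n hlt).1
    linarith [hn.2]
  · push Not at h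
    exact Or.inr ⟨h, (key T le_rfl h).2⟩

end Sequences

/-! ### The auction rules for a profile of reports -/

section Rules

variable {k : ℕ} (r : Fin k → ℕ → ℝ) (T : ℕ) (i : Fin k) (t : ℕ)

/-- The highest report of the other bidders in round `t`. -/
def rivalBid : ℝ := ⨆ j, if j = i then 0 else r j t

/-- The highest total report of the other bidders. -/
def rivalTotal : ℝ := ⨆ j, if j = i then 0 else ∑ t ∈ range T, r j t

/-- Bidder `i` makes the highest report in round `t`; ties are broken by the index. -/
def Wins : Prop := (∀ j, r j t ≤ r i t) ∧ ∀ j < i, r j t < r i t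

/-- The fraction of the item of round `t` intended for bidder `i`. -/
def quota : ℝ := portion (Wins r i) (r i) (rivalBid r i) (rivalTotal r T i / 32) T t

/-- The payment of bidder `i` due in round `t`. -/
def due : ℝ := dues (Wins r i) (r i) (rivalBid r i) (rivalTotal r T i / 32) T t

variable {r T i t}

lemma Wins.unique {j : Fin k} (hi : Wins r i t) (hj : Wins r j t) : i = j := by
  rcases lt_trichotomy i j with h | h | h
  · exact absurd (hi.1 j) (hj.2 i h).not_ge
  · exact h
  · exact absurd (hj.1 i) (hi.2 j h).not_ge

lemma exists_wins (hk : 0 < k) (r : Fin k → ℕ → ℝ) (t : ℕ) : ∃ i, Wins r i t := by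
  classical
  have : Nonempty (Fin k) := ⟨⟨0, hk⟩⟩
  obtain ⟨a, ha⟩ := Finite.exists_max fun j => r j t
  have hne : (univ.filter fun j => ∀ l, r l t ≤ r j t).Nonempty := ⟨a, by simpa using ha⟩
  refine ⟨_, (mem_filter.1 (min'_mem _ hne)).2, fun j hj => ?_⟩
  by_contra h
  have hj' : j ∈ univ.filter fun j => ∀ l, r l t ≤ r j t := by
    simpa using fun l => ((mem_filter.1 (min'_mem _ hne)).2 l).trans (not_lt.1 h)
  exact absurd (min'_le _ j hj') hj.not_ge

lemma le_rivalBid {j : Fin k} (h : j ≠ i) : r j t ≤ rivalBid r i t :=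
  (if_neg h).ge.trans <|
    le_ciSup (Set.finite_range fun j => if j = i then 0 else r j t).bddAbove j

lemma le_rivalTotal {j : Fin k} (h : j ≠ i) : ∑ t ∈ range T, r j t ≤ rivalTotal r T i :=
  (if_neg h).ge.trans <| le_ciSup
    (Set.finite_range fun j => if j = i then 0 else ∑ t ∈ range T, r j t).bddAbove j

lemma rivalBid_nonneg : 0 ≤ rivalBid r i t :=
  (if_pos rfl).ge.trans <|
    le_ciSup (Set.finite_range fun j => if j = i then 0 else r j t).bddAbove i

lemma rivalTotal_nonneg : 0 ≤ rivalTotal r T i :=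
  (if_pos rfl).ge.trans <| le_ciSup
    (Set.finite_range fun j => if j = i then 0 else ∑ t ∈ range T, r j t).bddAbove i

lemma rivalBid_le {c : ℝ} (hc : 0 ≤ c) (h : ∀ j, j ≠ i → r j t ≤ c) : rivalBid r i t ≤ c := by
  have : Nonempty (Fin k) := ⟨i⟩
  refine ciSup_le fun j => ?_
  split_ifs with hj
  exacts [hc, h j hj]

lemma rivalTotal_le {c : ℝ} (hc : 0 ≤ c) (h : ∀ j, j ≠ i → ∑ t ∈ range T, r j t ≤ c) :
    rivalTotal r T i ≤ c := by
  have : Nonempty (Fin k) := ⟨i⟩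
  refine ciSup_le fun j => ?_
  split_ifs with hj
  exacts [hc, h j hj]

lemma rivalBid_congr {r' : Fin k → ℕ → ℝ} (h : ∀ j, j ≠ i → r j = r' j) :
    rivalBid r i = rivalBid r' i := by
  funext t
  refine iSup_congr fun j => ?_
  split_ifs with hj
  exacts [rfl, by rw [h j hj]]

lemma rivalTotal_congr {r' : Fin k → ℕ → ℝ} (h : ∀ j, j ≠ i → r j = r' j) :
    rivalTotal r T i = rivalTotal r' T i := by
  refine iSup_congr fun j => ?_
  split_ifs with hj
  exacts [rfl, by rw [h j hj]]

lemma Wins.rivalBid_le (h : Wins r i t) (h0 : 0 ≤ r i t) : rivalBid r i t ≤ r i t :=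
  DynamicSale.rivalBid_le h0 fun j _ => h.1 j

lemma le_rivalBid_of_not_wins (h : ¬ Wins r i t) : r i t ≤ rivalBid r i t := by
  unfold Wins at h
  rw [not_and_or] at h
  push Not at h
  rcases h with ⟨j, hj⟩ | ⟨j, hj, hj'⟩
  · exact hj.le.trans (le_rivalBid fun e => by simp [e] at hj)
  · exact hj'.trans (le_rivalBid hj.ne)

lemma quota_nonneg : 0 ≤ quota r T i t := portion_nonneg

lemma quota_le_one : quota r T i t ≤ 1 := portion_le_one

lemma due_nonneg : 0 ≤ due r T i t := dues_nonneg rivalBid_nonneg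

lemma due_le (h0 : 0 ≤ r i t) : due r T i t ≤ quota r T i t * r i t :=
  dues_le (fun h => h.rivalBid_le h0) le_rivalBid_of_not_wins

/-- The payments of all bidders cover the price of the item in a second price auction, up to a
constant factor. -/
lemma rivalBid_le_sum_due (h : Wins r i t) : rivalBid r i t / 4 ≤ ∑ j, due r T j t := by
  refine le_trans ?_ (single_le_sum (fun j _ => due_nonneg) (mem_univ i))
  have h1 : (0 : ℝ) ≤ rivalBid r i t := rivalBid_nonneg
  have h2 := @quarter_le_share (r i) (rivalBid r i) (rivalTotal r T i / 32) T t
  have h3 := @fee_nonneg (r i) (rivalBid r i) (rivalTotal r T i / 32) T t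
  rw [due, dues, portion, if_pos h]
  nlinarith

/-- The revenue of the auction for truthful bidders. -/
lemma le_sum_sum_due (hr : ∀ i t, 0 ≤ r i t ∧ r i t ≤ 1)
    (hi : ∀ j, ∑ t ∈ range T, r j t ≤ ∑ t ∈ range T, r i t) :
    rivalTotal r T i / 32 - 1 ≤ ∑ j, ∑ t ∈ range T, due r T j t := by
  have hk : 0 < k := i.pos
  choose a ha using exists_wins hk r
  set Q := rivalTotal r T i with hQ
  have hQ0 : 0 ≤ Q := rivalTotal_nonneg
  have hQi : Q ≤ ∑ t ∈ range T, r i t :=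
    rivalTotal_le (sum_nonneg fun t _ => (hr i t).1) fun j _ => hi j
  have hsec : (∑ t ∈ range T, rivalBid r (a t) t) / 4 ≤ ∑ j, ∑ t ∈ range T, due r T j t := by
    rw [sum_comm, sum_div]
    exact sum_le_sum fun t _ => rivalBid_le_sum_due (ha t)
  -- In a round that `i` does not win, the winner's rival bid is at least the report of `i`, so no
  -- surplus needs to be counted.
  have hcum : ∑ t ∈ range T, r i t - ∑ t ∈ range T, rivalBid r (a t) t ≤
      cumGap (r i) (rivalBid r i) T := by
    rw [cumGap, ← sum_sub_distrib]
    refine sum_le_sum fun t _ => ?_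
    by_cases h : a t = i
    · rw [h]; exact le_max_left _ _
    · have := le_rivalBid (r := r) (t := t) (fun e => h e.symm : i ≠ a t)
      exact (sub_nonpos.2 this).trans gap_nonneg
  have hpos : ∀ j, 0 ≤ ∑ t ∈ range T, due r T j t := fun j => sum_nonneg fun t _ => due_nonneg
  -- For `Q ≤ 6` the claimed bound is negative. For `Q > 6` a surplus above `Q / 2` exceeds the
  -- joining threshold `8 * (Q / 32) + 3 / 2`.
  rcases le_or_gt Q 6 with h6 | h6
  · have := sum_nonneg fun j (_ : j ∈ univ) => hpos j
    linarith
  rcases le_or_gt (Q / 2) (∑ t ∈ range T, rivalBid r (a t) t) with h | h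
  · linarith
  · have h1 : Q / 32 ≤ ∑ t ∈ range T, due r T i t := by
      refine le_sum_dues (by linarith) (fun t => rivalBid_nonneg) (fun t => ?_) (by linarith)
      have : 0 ≤ rivalBid r i t := rivalBid_nonneg
      exact max_le (by linarith [(hr i t).2]) zero_le_one
    have h2 := single_le_sum (fun j _ => hpos j) (mem_univ i)
    linarith

lemma quota_of_not_wins (h : ¬ Wins r i t) : quota r T i t = 0 := if_neg h

lemma sum_quota_le_one (r : Fin k → ℕ → ℝ) (T t : ℕ) : ∑ i, quota r T i t ≤ 1 := by
  by_cases h : ∃ a, Wins r a t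
  · obtain ⟨a, ha⟩ := h
    rw [sum_eq_single a (fun j _ hj => quota_of_not_wins fun hw => hj (hw.unique ha)) (by simp)]
    exact quota_le_one
  · rw [sum_eq_zero fun j _ => quota_of_not_wins fun hw => h ⟨j, hw⟩]
    exact zero_le_one

end Rules

/-! ### The mechanism -/

/-- Reports of valuations. -/
abbrev Report (T : ℕ) : Type := {w : Fin T → ℝ // IsType w}

instance {T : ℕ} : Inhabited (Report T) := ⟨⟨fun _ => 0, fun _ => ⟨le_rfl, zero_le_one⟩⟩⟩

/-- Valuations as a sequence. The first round is reserved for the reports; its item is not sold. -/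
def seq {T : ℕ} (w : Fin T → ℝ) (t : ℕ) : ℝ :=
  if t = 0 then 0 else if h : t < T then w ⟨t, h⟩ else 0

lemma seq_zero {T : ℕ} (w : Fin T → ℝ) : seq w 0 = 0 := if_pos rfl

lemma seq_coe {T : ℕ} (w : Fin T → ℝ) {t : Fin T} (ht : (t : ℕ) ≠ 0) : seq w t = w t := by
  simp [seq, ht]

lemma seq_mem {T : ℕ} {w : Fin T → ℝ} (hw : IsType w) (t : ℕ) : 0 ≤ seq w t ∧ seq w t ≤ 1 := by
  unfold seq
  split_ifs
  · simp
  · exact hw _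
  · simp

lemma sum_le_sum_seq {T : ℕ} {w : Fin T → ℝ} (hw : IsType w) :
    ∑ t, w t ≤ ∑ t ∈ range T, seq w t + 1 := by
  rw [← Fin.sum_univ_eq_sum_range]
  cases T with
  | zero => simp
  | succ T =>
    rw [Fin.sum_univ_succ, Fin.sum_univ_succ, sum_congr rfl fun (t : Fin T) _ =>
      seq_coe w (t := t.succ) (by simp)]
    have h1 : seq w ((0 : Fin (T + 1)) : ℕ) = 0 := by simp [seq]
    linarith [(hw 0).2]

/-- The reports of all bidders as sequences. -/
def seqs {k T : ℕ} (R : Fin k → Report T) (i : Fin k) : ℕ → ℝ := seq (R i).1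

/-- The reports are the messages of the first round; `m` are the current messages. -/
def reports {k T : ℕ} (h : List (Record k ℝ (Report T))) (m : Fin k → Report T) :
    Fin k → Report T := (h.head?.map Record.msg).getD m

/-- So far, bidder `i` has paid what was due. -/
def Good {k T : ℕ} (R : Fin k → Report T) (h : List (Record k ℝ (Report T))) (i : Fin k) :
    Prop := ∀ n c, h[n]? = some c → c.pay i = due (seqs R) T i n

open Classical in
/-- The bidders report their valuations in the first round. Then they are told what is due, and
receive their quotas, as long as they pay what is due; those who always do so receive a bonus in
the end. -/
abbrev saleMechanism (k T : ℕ) : Mechanism k T where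
  Ω := Unit
  fintypeΩ := inferInstance
  coin := PMF.pure ()
  Sig := ℝ
  Msg := Report T
  nonemptyMsg := inferInstance
  signal _ t h i := if (t : ℕ) = 0 then 0 else due (seqs (reports h default)) T i t
  alloc _ t h m i :=
    if (t : ℕ) ≠ 0 ∧ Good (reports h m) h i then quota (seqs (reports h m)) T i t else 0
  alloc_nonneg _ t h m i := by
    split_ifs
    exacts [quota_nonneg, le_rfl]
  alloc_sum_le _ t h m := by
    refine le_trans (sum_le_sum fun i _ => ?_) (sum_quota_le_one (seqs (reports h m)) T t)
    split_ifs
    exacts [le_rfl, quota_nonneg]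
  reimb _ h i := if Good (reports h default) h i then 2 else 0
  reimb_nonneg _ h i := by split_ifs <;> norm_num

lemma Mechanism.hist_eq_ofFn {k T : ℕ} (M : Mechanism k T) (ω : M.Ω) (s : Fin k → M.Strat) (n : ℕ)
    (hn : n ≤ T) :
    M.hist ω s n hn = List.ofFn fun t : Fin n => M.outcome ω s ⟨t, t.2.trans_le hn⟩ := by
  induction n with
  | zero => rfl
  | succ n ih =>
    rw [List.ofFn_succ', Mechanism.hist, ih]
    simp only [List.concat_eq_append]
    congr 2
    rw [← ih]
    rfl

/-- The report of a bidder who plays the strategy `a`. -/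
def Strategy.report {T : ℕ} (a : Strategy T ℝ (Report T)) : Report T :=
  if h : 0 < T then a.msg ⟨0, h⟩ [] 0 else default

/-! ### The course of the game under a strategy profile -/

section Play

variable {k T : ℕ} (s : Fin k → Strategy T ℝ (Report T)) (i : Fin k)

/-- The course of the game. -/
abbrev play (t : Fin T) : Record k ℝ (Report T) := (saleMechanism k T).outcome () s t

/-- The history of the game. -/
abbrev past (n : ℕ) (hn : n ≤ T) : List (Record k ℝ (Report T)) := (saleMechanism k T).hist () s n hn

/-- The reported sequences. -/
abbrev bids : Fin k → ℕ → ℝ := seqs fun j => (s j).report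

variable {s i}

lemma past_eq_ofFn (n : ℕ) (hn : n ≤ T) :
    past s n hn = List.ofFn fun t : Fin n => play s ⟨t, t.2.trans_le hn⟩ :=
  (saleMechanism k T).hist_eq_ofFn () s n hn

lemma reports_past {n : ℕ} (hn : n ≤ T) (h0 : n ≠ 0) (m : Fin k → Report T) :
    reports (past s n hn) m = fun j => (s j).report := by
  obtain ⟨n, rfl⟩ := Nat.exists_eq_succ_of_ne_zero h0
  rw [reports, past_eq_ofFn, List.ofFn_succ]
  funext j
  have hT : 0 < T := Nat.lt_of_lt_of_le n.succ_pos hn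
  rw [Strategy.report, dif_pos hT]
  rfl

lemma good_past {n : ℕ} (hn : n ≤ T) (R : Fin k → Report T) :
    Good R (past s n hn) i ↔
      ∀ t (ht : t < n), (play s ⟨t, ht.trans_le hn⟩).pay i = due (seqs R) T i t := by
  rw [Good, past_eq_ofFn]
  refine forall_congr' fun t => ?_
  rw [List.getElem?_ofFn]
  by_cases ht : t < n <;> simp [ht]

open Classical in
lemma play_alloc (t : Fin T) : (play s t).alloc i =
    if (t : ℕ) ≠ 0 ∧ Good (fun j => (s j).report) (past s t t.2.le) i then quota (bids s) T i t
    else 0 := by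
  by_cases h : (t : ℕ) = 0
  · rw [if_neg (by simp [h])]
    exact if_neg (by simp [h])
  · have h1 : (play s t).alloc i =
        if (t : ℕ) ≠ 0 ∧ Good (reports (past s t t.2.le) (play s t).msg) (past s t t.2.le) i then
          quota (seqs (reports (past s t t.2.le) (play s t).msg)) T i t else 0 := rfl
    rw [h1, reports_past t.2.le h]

lemma play_sig {t : Fin T} (ht : (t : ℕ) ≠ 0) : (play s t).sig i = due (bids s) T i t := by
  have h1 : (play s t).sig i = if (t : ℕ) = 0 then 0 else
      due (seqs (reports (past s t t.2.le) default)) T i t := rfl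
  rw [h1, reports_past t.2.le ht, if_neg ht]

lemma play_pay (t : Fin T) : (play s t).pay i = (s i).pay t ((past s t t.2.le).map fun c => c.view i)
    ((play s t).sig i) ((play s t).alloc i) := rfl

open Classical in
lemma finalReimb_eq : (saleMechanism k T).finalReimb () s i =
    if Good (fun j => (s j).report) (past s T le_rfl) i then 2 else 0 := by
  by_cases h : T = 0
  · subst h
    rw [if_pos ((good_past _ _).2 fun t ht => absurd ht t.not_lt_zero)]
    exact if_pos ((good_past _ _).2 fun t ht => absurd ht t.not_lt_zero)
  · rw [← reports_past (s := s) le_rfl h default]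
    rfl

lemma saleMechanism_expect (f : Unit → ℝ) : (saleMechanism k T).expect f = f () := by
  change ∑ ω : Unit, ((PMF.pure ()) ω).toReal * f ω = f ()
  simp

lemma saleMechanism_utility (u : Fin T → ℝ) : (saleMechanism k T).utility i u s =
    ∑ t, ((play s t).alloc i * u t - (play s t).pay i) + (saleMechanism k T).finalReimb () s i :=
  saleMechanism_expect _

lemma saleMechanism_revenue : (saleMechanism k T).revenue s =
    ∑ i, ∑ t, (play s t).pay i - ∑ i, (saleMechanism k T).finalReimb () s i :=
  saleMechanism_expect _

/-- The maximal utility of bidder `i` without the bonus. -/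
def optimum (s : Fin k → Strategy T ℝ (Report T)) (i : Fin k) (u : Fin T → ℝ) : ℝ :=
  bestValue (seq u) (rivalBid (bids s) i) (rivalTotal (bids s) T i / 32) T

lemma optimum_nonneg {u : Fin T → ℝ} : 0 ≤ optimum s i u := bestValue_nonneg

/-- Only the reports of the others enter, and these are made before anything about bidder `i` can be
observed. -/
lemma optimum_update (a : Strategy T ℝ (Report T)) {u : Fin T → ℝ} :
    optimum (Function.update s i a) i u = optimum s i u := by
  have h : ∀ j, j ≠ i → bids (Function.update s i a) j = bids s j := fun j hj => by
    simp only [bids, seqs, Function.update_of_ne hj]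
  rw [optimum, rivalBid_congr h, rivalTotal_congr h, optimum]

/-- The payment of bidder `i` in round `t`. -/
def payment (s : Fin k → Strategy T ℝ (Report T)) (i : Fin k) (t : ℕ) : ℝ :=
  if h : t < T then (play s ⟨t, h⟩).pay i else 0

/-- The fraction received by bidder `i` in round `t`. -/
def receipt (s : Fin k → Strategy T ℝ (Report T)) (i : Fin k) (t : ℕ) : ℝ :=
  if h : t < T then (play s ⟨t, h⟩).alloc i else 0

lemma good_iff_payment {n : ℕ} (hn : n ≤ T) : Good (fun j => (s j).report) (past s n hn) i ↔
    ∀ t < n, payment s i t = due (bids s) T i t := by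
  rw [good_past]
  refine forall₂_congr fun t ht => ?_
  simp [payment, ht.trans_le hn]

/-- Passing to `seq u` changes only the first value, and nothing is allocated in the first round. -/
lemma alloc_mul_eq (u : Fin T → ℝ) (t : Fin T) :
    (play s t).alloc i * u t = receipt s i t * seq u t := by
  simp only [receipt, t.2, dif_pos]
  by_cases ht : (t : ℕ) = 0
  · rw [play_alloc, if_neg (by simp [ht])]; simp
  · rw [seq_coe u ht]

open Classical in
lemma receipt_mul_seq (u : Fin T → ℝ) {t : ℕ} (ht : t < T) : receipt s i t * seq u t =
    if ∀ n < t, payment s i n = due (bids s) T i n then quota (bids s) T i t * seq u t else 0 := by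
  simp only [receipt, ht, dif_pos]
  rw [play_alloc]
  by_cases h0 : t = 0
  · simp [h0, seq_zero]
  · simp only [good_iff_payment, ne_eq, h0, not_false_eq_true, true_and]
    split_ifs <;> simp

lemma utility_eq_sum (u : Fin T → ℝ) : (saleMechanism k T).utility i u s =
    ∑ t ∈ range T, (receipt s i t * seq u t - payment s i t) +
      (saleMechanism k T).finalReimb () s i := by
  rw [saleMechanism_utility,
    ← Fin.sum_univ_eq_sum_range fun t => receipt s i t * seq u t - payment s i t]
  congr 1
  refine sum_congr rfl fun t _ => ?_
  rw [alloc_mul_eq]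
  simp [payment]

lemma utility_of_forall_payment (u : Fin T → ℝ)
    (h : ∀ t < T, payment s i t = due (bids s) T i t) : (saleMechanism k T).utility i u s =
      ∑ t ∈ range T, (quota (bids s) T i t * seq u t - due (bids s) T i t) + 2 := by
  rw [utility_eq_sum, finalReimb_eq, if_pos ((good_iff_payment le_rfl).2 h)]
  congr 1
  refine sum_congr rfl fun t ht => ?_
  rw [receipt_mul_seq u (mem_range.1 ht), if_pos fun n hn => h n (hn.trans (mem_range.1 ht)),
    h t (mem_range.1 ht)]

/-- A bidder either falls short of the maximal utility, or pays what is due throughout. -/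
lemma utility_cases {u : Fin T → ℝ} (hu : IsType u) (hf : (s i).Feasible u) :
    (saleMechanism k T).utility i u s ≤ optimum s i u + 1 ∨
      (∀ t < T, payment s i t = due (bids s) T i t) ∧
      ∑ t ∈ range T, (quota (bids s) T i t * seq u t - due (bids s) T i t) ≤ optimum s i u := by
  classical
  have hP : 0 ≤ rivalTotal (bids s) T i / 32 := div_nonneg rivalTotal_nonneg (by norm_num)
  refine (sum_gain_cases (T := T) (u := seq u) (x := quota (bids s) T i) (q := due (bids s) T i)
    (p := payment s i) (a := receipt s i) (B := optimum s i u) (seq_mem hu)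
    (fun t => quota_le_one) (fun t ht => ?_)
    (fun t ht h => by rw [receipt_mul_seq u ht, if_pos h])
    (fun t ht m hm h => by rw [receipt_mul_seq u ht, if_neg fun h' => h (h' m hm)])
    (fun n hn h => sum_surplus_le hP hn h)).imp_left fun h => ?_
  · rw [show receipt s i t * seq u t = _ from (alloc_mul_eq u ⟨t, ht⟩).symm]
    simp only [payment, ht, dif_pos]
    exact hf _ _ _ _ ((saleMechanism k T).alloc_nonneg () _ _ _ _)
  · rw [utility_eq_sum, finalReimb_eq, if_neg fun hg => h.1 ((good_iff_payment le_rfl).1 hg),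
      add_zero]
    exact h.2

/-! ### Optimality of truthful play -/

/-- The strategy of a bidder who reports the valuations `w` and pays what is due. -/
def truthful (w : Report T) : Strategy T ℝ (Report T) where
  msg _ _ _ := w
  -- The truncation secures feasibility for arbitrary inputs; in actual play after the first round
  -- it is inactive, by `due_le`.
  pay t _ q r := max 0 (min q (r * w.1 t))

lemma truthful_feasible (w : Report T) : (truthful w).Feasible w.1 := fun t _ _ _ hr =>
  ⟨le_max_left _ _, max_le (mul_nonneg hr (w.2 t).1) (min_le_right _ _)⟩

lemma bids_of_truthful {w : Report T} (h : s i = truthful w) : bids s i = seq w.1 := by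
  simp only [bids, seqs, h, Strategy.report, truthful]
  split_ifs with hT
  · rfl
  · funext t
    simp only [seq, show ¬ t < T by lia, dif_neg, not_false_eq_true]

lemma due_zero : due (bids s) T i 0 = 0 := by
  have h0 : bids s i 0 = 0 := seq_zero _
  have h := due_le (r := bids s) (T := T) (i := i) (t := 0) h0.ge
  rw [h0, mul_zero] at h
  exact h.antisymm due_nonneg

lemma payment_of_truthful {w : Report T} (h : s i = truthful w) {t : ℕ} (ht : t < T) :
    payment s i t = due (bids s) T i t := by
  induction t using Nat.strong_induction_on with
  | _ t ih =>
    have hpay : payment s i t =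
        max 0 (min ((play s ⟨t, ht⟩).sig i) ((play s ⟨t, ht⟩).alloc i * w.1 ⟨t, ht⟩)) := by
      rw [payment, dif_pos ht, play_pay, h]
      rfl
    rw [hpay, alloc_mul_eq, receipt_mul_seq _ ht, if_pos fun n hn => ih n hn (hn.trans ht)]
    by_cases h0 : t = 0
    · subst h0
      rw [seq_zero, mul_zero, max_eq_left (min_le_right _ _), due_zero]
    · have hb := bids_of_truthful h
      rw [play_sig h0, ← hb, min_eq_left, max_eq_right due_nonneg]
      exact due_le (hb ▸ (seq_mem w.2 t).1)

lemma utility_of_truthful {w : Report T} (h : s i = truthful w) :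
    (saleMechanism k T).utility i w.1 s = optimum s i w.1 + 2 := by
  have hb := bids_of_truthful h
  have hP : 0 ≤ rivalTotal (bids s) T i / 32 := div_nonneg rivalTotal_nonneg (by norm_num)
  rw [utility_of_forall_payment _ fun t ht => payment_of_truthful h ht, optimum, ← hb]
  congr 1
  exact sum_surplus_truthful hP
    (fun t ht => ht.rivalBid_le (hb ▸ (seq_mem w.2 t).1)) fun t => le_rivalBid_of_not_wins

lemma utility_le {u : Fin T → ℝ} (hu : IsType u) (hf : (s i).Feasible u) :
    (saleMechanism k T).utility i u s ≤ optimum s i u + 2 := by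
  rcases utility_cases hu hf with h | h
  · linarith
  · rw [utility_of_forall_payment u h.1]; linarith [h.2]

variable (s i)

lemma utilityAgainst_truthful (w : Report T) :
    (saleMechanism k T).utilityAgainst i w.1 (truthful w) s = optimum s i w.1 + 2 := by
  rw [← optimum_update (truthful w)]
  exact utility_of_truthful (Function.update_self ..)

variable {s i}

lemma utilityAgainst_le (w : Report T) {a : Strategy T ℝ (Report T)} (ha : a.Feasible w.1) :
    (saleMechanism k T).utilityAgainst i w.1 a s ≤
      (saleMechanism k T).utilityAgainst i w.1 (truthful w) s := by
  rw [utilityAgainst_truthful, ← optimum_update a]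
  exact utility_le w.2 (by rwa [Function.update_self])

/-- No mixture of feasible strategies is better than the truthful strategy. -/
lemma mixedUtilityAgainst_le (w : Report T) (σ : PMF (Strategy T ℝ (Report T)))
    (hσ : ∀ b ∈ σ.support, b.Feasible w.1) :
    (saleMechanism k T).mixedUtilityAgainst i w.1 σ s ≤
      (saleMechanism k T).utilityAgainst i w.1 (truthful w) s := by
  set c := (saleMechanism k T).utilityAgainst i w.1 (truthful w) s with hc
  have hc0 : 0 ≤ c := by
    rw [hc, utilityAgainst_truthful]
    linarith [@optimum_nonneg k T s i w.1]
  have hsum : HasSum (fun b => (σ b).toReal * c) c := by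
    have h1 : HasSum (fun b => (σ b).toReal) 1 := by
      have := ENNReal.hasSum_toReal (f := σ) (by rw [σ.tsum_coe]; exact ENNReal.one_ne_top)
      rwa [← ENNReal.tsum_toReal_eq σ.apply_ne_top, σ.tsum_coe, ENNReal.toReal_one] at this
    simpa using h1.mul_right c
  rw [Mechanism.mixedUtilityAgainst]
  by_cases h : Summable fun b => (σ b).toReal * (saleMechanism k T).utilityAgainst i w.1 b s
  · rw [← hsum.tsum_eq]
    refine h.tsum_le_tsum (fun b => ?_) hsum.summable
    by_cases hb : b ∈ σ.support
    · exact mul_le_mul_of_nonneg_left (utilityAgainst_le w (hσ b hb)) ENNReal.toReal_nonneg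
    · rw [PMF.mem_support_iff, not_not] at hb
      simp [hb]
  -- A divergent expectation has the default value 0, which is harmless because the truthful utility
  -- is nonnegative.
  · rw [tsum_eq_zero_of_not_summable h]
    exact hc0

lemma mixedUtilityAgainst_pure (w : Fin T → ℝ) (b : Strategy T ℝ (Report T)) :
    (saleMechanism k T).mixedUtilityAgainst i w (PMF.pure b) s =
      (saleMechanism k T).utilityAgainst i w b s := by
  classical
  rw [Mechanism.mixedUtilityAgainst, tsum_eq_single b fun b' hb' => by
    rw [PMF.pure_apply_of_ne _ _ hb']; simp]
  simp

lemma nonDominated_truthful (i : Fin k) (w : Report T) :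
    (saleMechanism k T).NonDominated i w.1 (truthful w) := by
  refine ⟨truthful_feasible w, ?_⟩
  rintro ⟨σ, hσ, -, s, -, hs⟩
  exact hs.not_ge (mixedUtilityAgainst_le w σ hσ)

/-- The truthful strategy does at least as well as any dominating mixture, so it inherits the strict
inequality at the same opponents. -/
lemma isBounded_saleMechanism (k T : ℕ) : (saleMechanism k T).IsBounded := by
  intro i w hw a ha hdom
  lift w to Report T using hw
  rw [Mechanism.NonDominated, not_and, not_not] at hdom
  obtain ⟨σ, hσ, -, s, hs, hlt⟩ := hdom ha
  refine ⟨PMF.pure (truthful w), fun b hb => ?_, fun s _ => ?_, s, hs, ?_⟩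
  · rw [PMF.support_pure, Set.mem_singleton_iff] at hb
    exact hb ▸ nonDominated_truthful i w
  · rw [mixedUtilityAgainst_pure]; exact utilityAgainst_le w ha
  · rw [mixedUtilityAgainst_pure]; exact hlt.trans_le (mixedUtilityAgainst_le w σ hσ)

/-! ### Rigidity of non-dominated strategies -/

/-- A non-dominated strategy is as good as the truthful one against all opponents. -/
lemma utilityAgainst_of_nonDominated (w : Report T) {a : Strategy T ℝ (Report T)}
    (ha : (saleMechanism k T).NonDominated i w.1 a) (hs : (saleMechanism k T).Opponents i s) :
    (saleMechanism k T).utilityAgainst i w.1 a s = optimum s i w.1 + 2 := by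
  rw [← utilityAgainst_truthful]
  refine (utilityAgainst_le w ha.1).antisymm (not_lt.1 fun hlt => ha.2 ?_)
  refine ⟨PMF.pure (truthful w), fun b hb => ?_, fun s _ => ?_, s, hs, ?_⟩
  · rw [PMF.support_pure, Set.mem_singleton_iff] at hb
    exact hb ▸ truthful_feasible w
  · rw [mixedUtilityAgainst_pure]; exact utilityAgainst_le w ha.1
  · rwa [mixedUtilityAgainst_pure]

/-- A bidder with a non-dominated strategy pays what is due. -/
lemma payment_of_nonDominated (w : Report T) (ha : (saleMechanism k T).NonDominated i w.1 (s i))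
    (hs : (saleMechanism k T).Opponents i s) :
    (∀ t < T, payment s i t = due (bids s) T i t) ∧
      ∑ t ∈ range T, (quota (bids s) T i t * seq w.1 t - due (bids s) T i t) = optimum s i w.1 := by
  have h := utilityAgainst_of_nonDominated w ha hs
  rw [Mechanism.utilityAgainst, Function.update_eq_self] at h
  -- Utility `optimum + 2` excludes the deviating case, which is capped at `optimum + 1`.
  have h' := (utility_cases w.2 ha.1).resolve_left (by rw [h]; linarith)
  rw [utility_of_forall_payment _ h'.1] at h
  exact ⟨h'.1, by linarith⟩

/-- A bidder with a non-dominated strategy makes a truthful report. -/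
lemma report_of_nonDominated (hk : 2 ≤ k) (w : Report T) {a : Strategy T ℝ (Report T)}
    (ha : (saleMechanism k T).NonDominated i w.1 a) : seq a.report.1 = seq w.1 := by
  by_contra hne
  obtain ⟨t, ht⟩ := Function.ne_iff.1 hne
  have h0 : t ≠ 0 := by rintro rfl; exact ht (by rw [seq_zero, seq_zero])
  have htT : t < T := by
    by_contra hc
    exact ht (by simp [seq, hc])
  obtain ⟨c, hc0, hc1, hc⟩ : ∃ c, 0 ≤ c ∧ c ≤ 1 ∧
      (seq a.report.1 t < c ∧ c < seq w.1 t ∨ seq w.1 t < c ∧ c < seq a.report.1 t) := by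
    have h1 := seq_mem a.report.2 t
    have h2 := seq_mem w.2 t
    refine ⟨(seq a.report.1 t + seq w.1 t) / 2, by linarith, by linarith, ?_⟩
    rcases lt_or_gt_of_ne ht with h | h
    · left; constructor <;> linarith
    · right; constructor <;> linarith
  -- All opponents report `c`, strictly between the report and the true value, in round `t`, and the
  -- prohibitive bid 1 elsewhere; they never pay, which is feasible.
  set z : Fin T → ℝ := fun n => if (n : ℕ) = t then c else 1 with hz
  have hzt : IsType z := fun n => by
    simp only [hz]
    split_ifs
    exacts [⟨hc0, hc1⟩, ⟨zero_le_one, le_rfl⟩]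
  let s : Fin k → Strategy T ℝ (Report T) :=
    Function.update (fun _ => ⟨fun _ _ _ => ⟨z, hzt⟩, fun _ _ _ _ => 0⟩) i a
  have hsi : s i = a := Function.update_self ..
  have hsj : ∀ j, j ≠ i → s j = ⟨fun _ _ _ => ⟨z, hzt⟩, fun _ _ _ _ => 0⟩ := fun j hj =>
    Function.update_of_ne hj ..
  have hopp : (saleMechanism k T).Opponents i s := fun j hj => by
    refine ⟨z, hzt, fun n h q r hr => ?_⟩
    rw [hsj j hj]
    exact ⟨le_rfl, mul_nonneg hr (hzt n).1⟩
  have hbj : ∀ j, j ≠ i → bids s j = seq z := fun j hj => by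
    simp only [bids, seqs, hsj j hj, Strategy.report, dif_pos (t.zero_le.trans_lt htT)]
  have hbi : bids s i = seq a.report.1 := by simp only [bids, seqs, hsi]
  have hrival : ∀ n, rivalBid (bids s) i n = seq z n := fun n => by
    obtain ⟨j, hj⟩ : ∃ j, j ≠ i := by
      have : Nontrivial (Fin k) := Fin.nontrivial_iff_two_le.2 hk
      exact exists_ne i
    refine (rivalBid_le (seq_mem hzt n).1 fun l hl => by rw [hbj l hl]).antisymm ?_
    rw [← hbj j hj]
    exact le_rivalBid hj
  have heq := (payment_of_nonDominated w (hsi.symm ▸ ha) hopp).2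
  have hzc : seq z t = c := by simp [seq, hz, h0, htT]
  refine heq.not_lt (sum_surplus_lt (t := t) (fun n hn => ?_) (fun n hn hw => ?_) htT ?_ ?_)
  · by_contra hw
    exact (le_rivalBid_of_not_wins hw).not_gt hn
  · exact (hw.rivalBid_le (hbi ▸ (seq_mem a.report.2 n).1)).not_gt hn
  · intro n hn hnt
    rw [hrival]
    by_cases hn0 : n = 0
    · rw [hn0, seq_zero, seq_zero]
    · rw [show seq z n = 1 by simp [seq, hz, hn0, hn, hnt]]
      exact (seq_mem w.2 n).2
  · rw [hrival, hzc, hbi]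
    exact hc

end Play

/-- One of any two distinct bidders differs from `i`, so its total is bounded by the rival total;
the 1 accounts for the unsold first item. -/
lemma revSTB_le {k T : ℕ} (v : Fin k → Report T) {i : Fin k} (hk : 2 ≤ k) :
    revSTB (fun j => (v j).1) ≤ rivalTotal (seqs v) T i + 1 := by
  have h : ∀ j, j ≠ i → ∑ t, (v j).1 t ≤ rivalTotal (seqs v) T i + 1 := fun j hj => by
    have h1 := sum_le_sum_seq (v j).2
    have h2 := le_rivalTotal (r := seqs v) (T := T) hj
    simp only [seqs] at h1 h2 ⊢
    linarith
  have hne : Nonempty {p : Fin k × Fin k // p.1 ≠ p.2} := by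
    have : Nontrivial (Fin k) := Fin.nontrivial_iff_two_le.2 hk
    obtain ⟨a, b, hab⟩ := exists_pair_ne (Fin k)
    exact ⟨(a, b), hab⟩
  refine ciSup_le fun p => ?_
  by_cases h1 : p.1.1 = i
  · exact min_le_of_right_le (h _ fun h2 => p.2 (h1.trans h2.symm))
  · exact min_le_of_left_le (h _ h1)

/-- The revenue if all bidders play non-dominated strategies. -/
lemma revenue_of_nonDominated {k T : ℕ} (hk : 2 ≤ k) (v : Fin k → Report T)
    (s : Fin k → Strategy T ℝ (Report T))
    (hs : ∀ i, (saleMechanism k T).NonDominated i (v i).1 (s i)) :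
    (saleMechanism k T).revenue s = ∑ i, ∑ t ∈ range T, due (seqs v) T i t - k * 2 := by
  have hopp : ∀ i, (saleMechanism k T).Opponents i s := fun i j _ =>
    ⟨(v j).1, (v j).2, (hs j).1⟩
  have hb : bids s = seqs v := funext fun i => report_of_nonDominated hk (v i) (hs i)
  have hpay : ∀ i, ∀ t < T, payment s i t = due (bids s) T i t := fun i =>
    (payment_of_nonDominated (v i) (hs i) (hopp i)).1
  rw [saleMechanism_revenue]
  congr 1
  · refine sum_congr rfl fun i _ => ?_
    rw [← Fin.sum_univ_eq_sum_range fun t => due (seqs v) T i t]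
    refine sum_congr rfl fun t _ => ?_
    rw [← hb, ← hpay i t t.2, payment, dif_pos t.2]
  · rw [sum_congr rfl fun i _ => by
      rw [finalReimb_eq, if_pos ((good_iff_payment le_rfl).2 (hpay i))]]
    simp

end DynamicSale

end

theorem corollary4p6 :
    ∃ α G C : ℝ, 0 < α ∧ ∀ k : ℕ, 2 ≤ k → ∀ T : ℕ, ∃ M : DynamicSale.Mechanism k T,
      (∀ ω h i, M.reimb ω h i ≤ G) ∧
      M.IsBounded ∧
      ∀ v : Fin k → Fin T → ℝ, (∀ i, DynamicSale.IsType (v i)) →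
        ∀ π : PMF (Fin k → M.Strat),
          (∀ s ∈ π.support, ∀ i, M.NonDominated i (v i) (s i)) →
          α * DynamicSale.revSTB v - C * k ≤ M.mixedRevenue π := by
  classical
  refine ⟨1 / 32, 2, 4, by norm_num, fun k hk T => ⟨DynamicSale.saleMechanism k T, ?_,
    DynamicSale.isBounded_saleMechanism k T, fun v hv π hπ => ?_⟩⟩
  · intro ω h i
    change (if DynamicSale.Good _ h i then (2 : ℝ) else 0) ≤ 2
    split_ifs <;> norm_num
  · lift v to Fin k → DynamicSale.Report T using hv
    set ρ := ∑ i, ∑ t ∈ Finset.range T, DynamicSale.due (DynamicSale.seqs v) T i t - k * 2 with hρ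
    -- The revenue is the same for every profile in the support, so correlation between the
    -- strategies plays no role.
    have hrev : (DynamicSale.saleMechanism k T).mixedRevenue π = ρ := by
      have h1 : ∀ s, (π s).toReal * (DynamicSale.saleMechanism k T).revenue s =
          (π s).toReal * ρ := fun s => by
        by_cases hs : s ∈ π.support
        · rw [DynamicSale.revenue_of_nonDominated hk v s (hπ s hs)]
        · rw [PMF.mem_support_iff, not_not] at hs
          simp [hs]
      rw [DynamicSale.Mechanism.mixedRevenue, tsum_congr h1, tsum_mul_right,
        ← ENNReal.tsum_toReal_eq π.apply_ne_top, π.tsum_coe, ENNReal.toReal_one, one_mul]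
    have : Nonempty (Fin k) := ⟨⟨0, by lia⟩⟩
    obtain ⟨i, hi⟩ := Finite.exists_max fun j => ∑ t ∈ Finset.range T, DynamicSale.seqs v j t
    have h2 := DynamicSale.le_sum_sum_due (r := DynamicSale.seqs v) (fun j t => DynamicSale.seq_mem (v j).2 t) hi
    have h3 := DynamicSale.revSTB_le v (i := i) hk
    have h4 : (2 : ℝ) ≤ k := by exact_mod_cast hk
    rw [hrev, hρ]
    linarith
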